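/- **Setting.** Let $X\subset\mathbb R^p$ be a nonempty compact convex set contained in a cube of edge length $D\ge 0$, with diameter $D_X=\max_{x,x'\in X}\|x-x'\|$ (Euclidean norm). Let $\Xi\subset\mathbb R^d$, let $\nu$ be a probability distribution on $\Xi$, and let $F:X\times\Xi\to\mathbb R$ be measurable in $\xi$ for every $x\in X$, convex in $x$ for every $\xi\in\Xi$, and such that, for constants $L_F\ge 0$, $\gamma\in(0,1]$, $M_F>0$, $$|F(x,\xi)-F(y,\xi)|\le L_F\|x-y\|^\gamma,\qquad |F(x,\xi)|\le M_F\qquad\text{for all }x,y\in X,\ \xi\in\Xi .$$ Put $f(x)=\int F(x,\xi)\,\nu(d\xi)$. Let $m,n\ge 1$ be integers, $N=mn$, $\epsilon>0$, $\rho>0$. For $\xi^N=(\xi_1,\dots,\xi_N)\in\Xi^N$ and $i=1,\dots,m$ let $\xi^n_i=(\xi_{(i-1)n+1},\dots,\xi_{in})$, $$f_n(x;\xi^n_i)=\frac1n\sum_{j=1}^nF(x,\xi_{(i-1)n+j}),\qquad \delta^f_n(\xi^n_i)=\sup_{x\in X}|f_n(x;\xi^n_i)-f(x)| .$$ For a continuous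 function $g$ on $X$, its $\epsilon$-optimal set is $\{x\in X: g(x)\le\min_X g+\epsilon\}$. Let $X^*_\epsilon$ be the $\epsilon$-optimal set of $f$. Given points $x_{n,\epsilon}(\xi^n_i)$ in the $\epsilon$-optimal set of $f_n(\cdot;\xi^n_i)$, $i=1,\dots,m$, let $\hat X_{N,\rho,\epsilon}(\xi^N)$ be the $\epsilon$-optimal set of $$x\mapsto\frac1m\sum_{i=1}^mf_n(x;\xi^n_i)+\frac\rho2\Big\|x-\frac1m\sum_{i=1}^mx_{n,\epsilon}(\xi^n_i)\Big\|^2 .$$ For sets $A,B$ put $\Delta(A,B)=\sup_{a\in A}\inf_{b\in B}\|a-b\|$. For $\lambda\in(0,\tfrac12)$ put $$N_F=L_FD^\gamma p^{\gamma/2}+M_F\sqrt{2\log2}+\frac{M_F\,p^{1/2}}{\sqrt{\gamma(1-2\lambda)e}} .$$ Let $\tilde\xi^N=(\tilde\xi_1,\dots,\tilde\xi_N)$ consist of i.i.d. $\Xi$-valued random variables with distribution $\nu$; in parts 2 and 3 the chosen $\epsilon$-optimal solutions $x_{n,\epsilon}(\tilde\xi^n_i)$ are assumed to be random variables (measurable).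 **Theorem 3.2.** The following hold. 1. For every $\xi^N\in\Xi^N$ and every choice of the points $x_{n,\epsilon}(\xi^n_i)$, $$\Delta(\hat X_{N,\rho,\epsilon}(\xi^N),X^*_\epsilon)\le\frac{\frac2m\sum_{j=1}^m\delta^f_n(\xi^n_j)+\frac1{m^2}\sum_{i,j=1,\,i\ne j}^m\big[\delta^f_n(\xi^n_i)+\delta^f_n(\xi^n_j)\big]}{\epsilon}\,D_X+2\sqrt{\epsilon/\rho} .$$ 2. $\Delta(\hat X_{N,\rho,\epsilon}(\tilde\xi^N),X^*_\epsilon)$ is integrable and $$\mathbb E\big[\Delta(\hat X_{N,\rho,\epsilon}(\tilde\xi^N),X^*_\epsilon)\big]\le\frac{D_XN_F}{\epsilon}\,\frac{8m-4}{m\,n^\lambda}+2\sqrt{\epsilon/\rho} .$$ 3. Let $\rho=n$, suppose $D_X>0$, and put $C=\frac{\epsilon^{3/2}}{D_X}+\frac{(4m-2)N_F}{m}$. Then for every $t\ge0$ $$\Pr\Big\{\frac{\epsilon n^\lambda}{2D_X}\,\Delta(\hat X_{N,\rho,\epsilon}(\tilde\xi^N),X^*_\epsilon)\ge C+t\Big\}\le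 m\exp\Big\{-\frac{m^2t^2}{2M_F^2(2m-1)^2}\Big\} .$$ -/

import Mathlib

open MeasureTheory ProbabilityTheory

noncomputable section

namespace CompromiseSP

/-- The pessimistic distance `Δ(A, B) = sup_{a ∈ A} inf_{b ∈ B} ‖a - b‖`. -/
def pessimisticDist {E : Type*} [NormedAddCommGroup E] (A B : Set E) : ℝ :=
  ⨆ a : A, ⨅ b : B, ‖(a : E) - (b : E)‖

/-- The optimal value of `min_{x ∈ X} g x`. -/
def optValue {E : Type*} (X : Set E) (g : E → ℝ) : ℝ :=
  ⨅ x : X, g x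

/-- The `ε`-optimal solution set of `min_{x ∈ X} g x`. -/
def epsOptSet {E : Type*} (X : Set E) (g : E → ℝ) (ε : ℝ) : Set E :=
  {x | x ∈ X ∧ g x ≤ optValue X g + ε}

/-- The true objective `f x = 𝔼[F (x, ξ)]`, where `ξ` has distribution `ν`. -/
def trueObj {E S : Type*} [MeasurableSpace S] (F : E → S → ℝ) (ν : Measure S) (x : E) : ℝ :=
  ∫ s, F x s ∂ν

/-- The sample average `f_n (x; s) = (1/n) ∑_j F (x, s_j)`. -/
def saaObj {E S : Type*} (F : E → S → ℝ) {n : ℕ} (s : Fin n → S) (x : E) : ℝ :=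
  (1 / (n : ℝ)) * ∑ j, F x (s j)

/-- The sample of replication `i`: the `i`-th of `m` consecutive blocks of length `n` of the
whole sample (`finProdFinEquiv (i, j)` is the index `n * i + j`, counting from zero). -/
def block {S : Type*} {m n : ℕ} (s : Fin (m * n) → S) (i : Fin m) : Fin n → S :=
  fun j => s (finProdFinEquiv (i, j))

/-- The average of the `m` replication objectives. -/
def aggObj {E S : Type*} (F : E → S → ℝ) {m n : ℕ} (s : Fin (m * n) → S) (x : E) : ℝ :=
  (1 / (m : ℝ)) * ∑ i : Fin m, saaObj F (block s i) x

/-- The objective of the inexact compromise problem, where `z i` is the solution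
delivered by replication `i` and `ρ` is the regularization parameter. -/
def compromiseObj {E S : Type*} [NormedAddCommGroup E] [NormedSpace ℝ E] (F : E → S → ℝ)
    {m n : ℕ} (ρ : ℝ) (s : Fin (m * n) → S) (z : Fin m → E) (x : E) : ℝ :=
  aggObj F s x + ρ / 2 * ‖x - (1 / (m : ℝ)) • ∑ i, z i‖ ^ 2

/-- The uniform sampling error `δ(s) = sup_{x ∈ X} |f_n (x; s) - f x|`. -/
def supError {E S : Type*} [MeasurableSpace S] (X : Set E) (F : E → S → ℝ) (ν : Measure S)
    {n : ℕ} (s : Fin n → S) : ℝ :=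
  ⨆ x : X, |saaObj F s x - trueObj F ν x|

/-- The pessimistic distance from the `ε`-optimal set of the inexact compromise problem to
the `ε`-optimal set of the true problem. -/
def compromiseDist {E S : Type*} [NormedAddCommGroup E] [NormedSpace ℝ E] [MeasurableSpace S]
    (X : Set E) (F : E → S → ℝ) (ν : Measure S) {m n : ℕ} (ρ ε : ℝ)
    (s : Fin (m * n) → S) (z : Fin m → E) : ℝ :=
  pessimisticDist (epsOptSet X (compromiseObj F ρ s z) ε) (epsOptSet X (trueObj F ν) ε)

/-- `X` lies in a closed cube (of any orientation and position) with edge length `D`. -/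
def InCube {p : ℕ} (X : Set (EuclideanSpace ℝ (Fin p))) (D : ℝ) : Prop :=
  ∃ (b : OrthonormalBasis (Fin p) ℝ (EuclideanSpace ℝ (Fin p))) (c : Fin p → ℝ),
    ∀ x ∈ X, ∀ i, b.repr x i ∈ Set.Icc (c i) (c i + D)

/-- The constant
`N_F = L D^γ p^{γ/2} + M √(2 log 2) + M p^{1/2} / √(γ (1 - 2 lam) e)`. -/
def constNF (p : ℕ) (D L γ M lam : ℝ) : ℝ :=
  L * D ^ γ * (p : ℝ) ^ (γ / 2) + M * √(2 * Real.log 2)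
    + M * √(p : ℝ) / √(γ * (1 - 2 * lam) * Real.exp 1)

end CompromiseSP

end

namespace CompromiseSP

/-! The deterministic bound rests on one device: for convex `g`, a point of `X` that misses
`ε`-optimality by `β` becomes `ε`-optimal after moving the fraction `β / (ε + β)` of the way to a
minimizer, hence after a distance at most `β / ε * diam X` (`exists_mem_epsOptSet_norm_sub_le`). Let
`G` be the mean of the replication objectives and `zb` the mean of their solutions. Jensen's
inequality bounds `G zb` by the double mean of `g i (z j)`; replacing `g i` by `g j` off the
diagonal costs `δ i + δ j`, so `zb` misses `ε`-optimality for `G` by at most the off-diagonal term.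
A compromise solution either lies within `2 * √(ε / ρ)` of `zb` or pays a penalty of at least `2 *
ε`, which forces its own `G`-value to be small. Either way a move reaches the `ε`-optimal set of
`G`, and a second one, with excess twice the mean of the `δ i`, reaches that of `f`.

For the probabilistic parts the bound collapses to a multiple of `∑ j, δ j`. A net of `X` with
polynomially many points in `n` reduces each `δ j` to finitely many sample means, which are
sub-Gaussian with proxy `M ^ 2 / n` by Hoeffding's lemma. The logarithm of the net size is absorbed
by `n ^ (1 - 2 * lam)`, which produces `constNF`. An integrable majorant of `δ j` gives the
expectation, a union bound the tail. Neither needs `δ j` to be measurable; only the pessimistic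
distance is shown to be measurable, so that it is integrable. -/

/-! ### Optimal values, `ε`-optimal sets and the pessimistic distance -/

lemma optValue_eq_of_isMinOn {E : Type*} {X : Set E} {g : E → ℝ} {x₀ : E} (hx₀ : x₀ ∈ X)
    (h : ∀ y ∈ X, g x₀ ≤ g y) : optValue X g = g x₀ := by
  have : Nonempty X := ⟨⟨x₀, hx₀⟩⟩
  refine le_antisymm (ciInf_le (f := fun x : X => g x) ⟨g x₀, ?_⟩ ⟨x₀, hx₀⟩)
    (le_ciInf fun y => h y y.2)
  rintro _ ⟨y, rfl⟩
  exact h y y.2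

lemma exists_minimizer {E : Type*} [TopologicalSpace E] {X : Set E} (hne : X.Nonempty)
    (hcpt : IsCompact X) {g : E → ℝ} (hg : ContinuousOn g X) :
    ∃ x₀ ∈ X, (∀ y ∈ X, g x₀ ≤ g y) ∧ optValue X g = g x₀ := by
  obtain ⟨x₀, hx₀, h⟩ := hcpt.exists_isMinOn hne hg
  exact ⟨x₀, hx₀, fun y hy => h hy, optValue_eq_of_isMinOn hx₀ fun y hy => h hy⟩

lemma optValue_le {E : Type*} [TopologicalSpace E] {X : Set E}
    (hcpt : IsCompact X) {g : E → ℝ} (hg : ContinuousOn g X) {y : E} (hy : y ∈ X) :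
    optValue X g ≤ g y := by
  obtain ⟨x₀, -, h, h'⟩ := exists_minimizer ⟨y, hy⟩ hcpt hg
  exact h'.trans_le (h y hy)

/-- Moving a nearly optimal point towards a minimizer of a convex function reaches the
`ε`-optimal set after a distance controlled by the excess `β`. -/
lemma exists_mem_epsOptSet_norm_sub_le {E : Type*} [NormedAddCommGroup E] [NormedSpace ℝ E]
    {X : Set E} (hcpt : IsCompact X) {g : E → ℝ} (hconv : ConvexOn ℝ X g)
    (hcont : ContinuousOn g X) {ε β : ℝ} (hε : 0 < ε) (hβ : 0 ≤ β) {x : E} (hx : x ∈ X)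
    (hgx : g x ≤ optValue X g + ε + β) :
    ∃ y ∈ epsOptSet X g ε, ‖x - y‖ ≤ β / ε * Metric.diam X := by
  obtain ⟨x₀, hx₀, hmin, hopt⟩ := exists_minimizer ⟨x, hx⟩ hcpt hcont
  have hpos : 0 < ε + β := by linarith
  set t := β / (ε + β) with ht
  have ht0 : 0 ≤ t := by positivity
  have ht1 : 1 - t = ε / (ε + β) := by rw [ht]; field_simp; ring
  have ht1' : 0 ≤ 1 - t := by rw [ht1]; positivity
  refine ⟨(1 - t) • x + t • x₀, ⟨hconv.1 hx hx₀ ht1' ht0 (by ring), ?_⟩, ?_⟩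
  · have h := hconv.2 hx hx₀ ht1' ht0 (by ring)
    simp only [smul_eq_mul] at h
    have h2 : (1 - t) * g x ≤ (1 - t) * (g x₀ + ε + β) :=
      mul_le_mul_of_nonneg_left (by linarith) ht1'
    -- This identity dictates `t`: the excess over the minimum shrinks from `ε + β` to exactly `ε`.
    have h3 : (1 - t) * (ε + β) = ε := by rw [ht1]; field_simp
    rw [hopt]
    linarith
  · have : x - ((1 - t) • x + t • x₀) = t • (x - x₀) := by module
    rw [this, norm_smul, Real.norm_of_nonneg ht0, ← dist_eq_norm]
    refine mul_le_mul ?_ (Metric.dist_le_diam_of_mem hcpt.isBounded hx hx₀) dist_nonneg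
      (by positivity)
    exact div_le_div_of_nonneg_left hβ hε (by linarith)

lemma sum_offDiag_eq {ι : Type*} [Fintype ι] [DecidableEq ι] (h : ι → ι → ℝ) :
    ∑ q ∈ (Finset.univ : Finset ι).offDiag, h q.1 q.2
      = ∑ j, ∑ i, if i = j then 0 else h i j := by
  have hfil : (Finset.univ : Finset ι).offDiag
      = (Finset.univ ×ˢ Finset.univ).filter fun q => q.1 ≠ q.2 := by ext; simp
  rw [hfil, Finset.sum_filter, Finset.sum_product_right]
  refine Finset.sum_congr rfl fun j _ => Finset.sum_congr rfl fun i _ => ?_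
  by_cases h : i = j <;> simp [h]

/-- Each `δ j` occurs `m - 1` times in either position of an ordered pair. -/
lemma sum_offDiag_add {m : ℕ} (δ : Fin m → ℝ) :
    ∑ q ∈ (Finset.univ : Finset (Fin m)).offDiag, (δ q.1 + δ q.2)
      = 2 * ((m : ℝ) - 1) * ∑ j, δ j := by
  rw [sum_offDiag_eq fun i j => δ i + δ j]
  have (j : Fin m) : (∑ i, if i = j then 0 else δ i + δ j)
      = ∑ i, (δ i + δ j) - (δ j + δ j) := by
    have hite (i : Fin m) : (if i = j then 0 else δ i + δ j)
        = δ i + δ j - if i = j then δ i + δ j else 0 := by split_ifs <;> simp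
    simp only [hite, Finset.sum_sub_distrib, Finset.sum_ite_eq', Finset.mem_univ, if_true]
  simp only [this, Finset.sum_sub_distrib, Finset.sum_add_distrib, Finset.sum_const,
    Finset.card_univ, Fintype.card_fin, nsmul_eq_mul, ← Finset.mul_sum]
  ring

lemma bound_eq {m : ℕ} (hm : 1 ≤ m) (δ : Fin m → ℝ) :
    2 / (m : ℝ) * ∑ j, δ j
        + 1 / (m : ℝ) ^ 2 * ∑ q ∈ (Finset.univ : Finset (Fin m)).offDiag, (δ q.1 + δ q.2)
      = (4 * m - 2) / (m : ℝ) ^ 2 * ∑ j, δ j := by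
  rw [sum_offDiag_add]
  have : (m : ℝ) ≠ 0 := by positivity
  field_simp
  ring

lemma pessimisticDist_le {E : Type*} [NormedAddCommGroup E] {A B : Set E} {c : ℝ} (hc : 0 ≤ c)
    (h : ∀ a ∈ A, ∃ b ∈ B, ‖a - b‖ ≤ c) : pessimisticDist A B ≤ c := by
  -- The real supremum over an empty `A` is `0`, which is why `0 ≤ c` is required.
  refine Real.iSup_le (fun a => ?_) hc
  obtain ⟨b, hb, hab⟩ := h a a.2
  refine (ciInf_le (f := fun b : B => ‖(a : E) - b‖) ⟨0, ?_⟩ ⟨b, hb⟩).trans hab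
  rintro _ ⟨y, rfl⟩
  exact norm_nonneg _

lemma pessimisticDist_nonneg {E : Type*} [NormedAddCommGroup E] (A B : Set E) : 0 ≤ pessimisticDist A B :=
  Real.iSup_nonneg fun _ => Real.iInf_nonneg fun _ => norm_nonneg _

/-! ### The deterministic estimate -/

section Deterministic

variable {E : Type*} [NormedAddCommGroup E] [NormedSpace ℝ E] {X : Set E} {m : ℕ}
  {g : Fin m → E → ℝ}

lemma convexOn_average (hX : Convex ℝ X) (hg : ∀ i, ConvexOn ℝ X (g i)) :
    ConvexOn ℝ X (fun x => (1 / (m : ℝ)) * ∑ i, g i x) := by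
  refine ConvexOn.smul (c := 1 / (m : ℝ)) (by positivity) (f := fun x => ∑ i, g i x) ⟨hX, ?_⟩
  intro x hx y hy a b ha hb hab
  simp only [smul_eq_mul, Finset.mul_sum, ← Finset.sum_add_distrib]
  exact Finset.sum_le_sum fun i _ => (hg i).2 hx hy ha hb hab

lemma average_mem (hm : 1 ≤ m) (hX : Convex ℝ X) {z : Fin m → E} (hz : ∀ i, z i ∈ X) :
    (1 / (m : ℝ)) • ∑ i, z i ∈ X := by
  have : (m : ℝ) ≠ 0 := by positivity
  rw [Finset.smul_sum]
  exact hX.sum_mem (fun _ _ => by positivity) (by simp [this]) fun i _ => hz i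

/-- The average of replication solutions is nearly optimal for the average objective. -/
lemma average_objective_le (hm : 1 ≤ m) (hcpt : IsCompact X)
    (hX : Convex ℝ X) (hg : ∀ i, ConvexOn ℝ X (g i)) (hgc : ∀ i, ContinuousOn (g i) X)
    {f : E → ℝ} {δ : Fin m → ℝ} (hδ : ∀ i, ∀ x ∈ X, |g i x - f x| ≤ δ i) {ε : ℝ}
    {z : Fin m → E} (hz : ∀ j, z j ∈ epsOptSet X (g j) ε) {x : E} (hx : x ∈ X) :
    (1 / (m : ℝ)) * ∑ i, g i ((1 / (m : ℝ)) • ∑ j, z j) ≤ (1 / (m : ℝ)) * ∑ i, g i x + ε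
      + 1 / (m : ℝ) ^ 2
        * ∑ q ∈ (Finset.univ : Finset (Fin m)).offDiag, (δ q.1 + δ q.2) := by
  have hm0 : (m : ℝ) ≠ 0 := by positivity
  have h1 := (convexOn_average hX hg).map_sum_le (t := Finset.univ) (w := fun _ => 1 / (m : ℝ))
    (p := z) (fun _ _ => by positivity) (by simp [hm0]) (fun i _ => (hz i).1)
  rw [← Finset.smul_sum] at h1
  refine h1.trans ?_
  -- On the diagonal `ε`-optimality of `z j` for `g j` suffices; off it, passing from `g i` to `g j`
  -- through `f` at the point `z j` costs `δ i + δ j`.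
  have h2 (i j : Fin m) :
      g i (z j) ≤ g j x + ε + if i = j then 0 else δ i + δ j := by
    have hj := (hz j).2
    have hle := optValue_le hcpt (hgc j) hx
    split_ifs with hij
    · subst hij; linarith
    · have a := (abs_le.1 (hδ i _ (hz j).1)).2
      have b := (abs_le.1 (hδ j _ (hz j).1)).1
      linarith
  have h3 : ∑ j, ∑ i, g i (z j)
      ≤ ∑ j, ∑ i, (g j x + ε + if i = j then 0 else δ i + δ j) :=
    Finset.sum_le_sum fun j _ => Finset.sum_le_sum fun i _ => h2 i j
  rw [sum_offDiag_eq fun i j => δ i + δ j]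
  simp only [Finset.sum_add_distrib, Finset.sum_const, Finset.card_univ, Fintype.card_fin,
    nsmul_eq_mul, ← Finset.mul_sum] at h3
  simp only [smul_eq_mul, ← Finset.mul_sum]
  calc 1 / (m : ℝ) * (1 / m * ∑ j, ∑ i, g i (z j))
      = 1 / (m : ℝ) ^ 2 * ∑ j, ∑ i, g i (z j) := by ring
    _ ≤ 1 / (m : ℝ) ^ 2 * _ := mul_le_mul_of_nonneg_left h3 (by positivity)
    _ = _ := by field_simp

/-- Every `ε`-optimal point of the compromise problem is near the `ε`-optimal set of `f`. -/
lemma exists_mem_epsOptSet_near_compromise (hm : 1 ≤ m) (hcpt : IsCompact X)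
    (hX : Convex ℝ X) (hg : ∀ i, ConvexOn ℝ X (g i)) (hgc : ∀ i, ContinuousOn (g i) X)
    {f : E → ℝ} (hf : ConvexOn ℝ X f) (hfc : ContinuousOn f X)
    {δ : Fin m → ℝ} (hδ : ∀ i, ∀ x ∈ X, |g i x - f x| ≤ δ i) {ε ρ : ℝ} (hε : 0 < ε) (hρ : 0 < ρ)
    {z : Fin m → E} (hz : ∀ j, z j ∈ epsOptSet X (g j) ε) {x : E}
    (hx : x ∈ epsOptSet X (fun x => (1 / (m : ℝ)) * ∑ i, g i x
      + ρ / 2 * ‖x - (1 / (m : ℝ)) • ∑ i, z i‖ ^ 2) ε) :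
    ∃ y ∈ epsOptSet X f ε, ‖x - y‖ ≤
      (2 / (m : ℝ) * ∑ j, δ j + 1 / (m : ℝ) ^ 2
        * ∑ q ∈ (Finset.univ : Finset (Fin m)).offDiag, (δ q.1 + δ q.2)) / ε * Metric.diam X
      + 2 * √(ε / ρ) := by
  have hm0 : (m : ℝ) ≠ 0 := by positivity
  have hδ0 (i : Fin m) : 0 ≤ δ i := (abs_nonneg _).trans (hδ i x hx.1)
  set G : E → ℝ := fun x => (1 / (m : ℝ)) * ∑ i, g i x with hG
  have hGconv : ConvexOn ℝ X G := convexOn_average hX hg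
  have hGcont : ContinuousOn G X :=
    continuousOn_const.mul (continuousOn_finsetSum _ fun i _ => hgc i)
  set zb := (1 / (m : ℝ)) • ∑ i, z i with hzb
  have hzbX : zb ∈ X := average_mem hm hX fun i => (hz i).1
  set A := 1 / (m : ℝ) ^ 2 * ∑ q ∈ (Finset.univ : Finset (Fin m)).offDiag, (δ q.1 + δ q.2)
    with hA
  have hA0 : 0 ≤ A := mul_nonneg (by positivity)
    (Finset.sum_nonneg fun q _ => add_nonneg (hδ0 _) (hδ0 _))
  obtain ⟨x₁, hx₁, -, hopt₁⟩ := exists_minimizer ⟨x, hx.1⟩ hcpt hGcont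
  have hGzb : G zb ≤ optValue X G + ε + A := by
    rw [hopt₁]; exact average_objective_le hm hcpt hX hg hgc hδ hz hx₁
  -- Test the compromise problem at `zb`, where the penalty vanishes.
  have hGx : G x + ρ / 2 * ‖x - zb‖ ^ 2 ≤ G zb + ε := by
    have hc : ContinuousOn (fun x => G x + ρ / 2 * ‖x - zb‖ ^ 2) X :=
      hGcont.add (by fun_prop)
    have := optValue_le hcpt hc hzbX
    have h2 := hx.2
    simp only [sub_self, norm_zero] at this
    linarith
  obtain ⟨y₁, hy₁, hxy₁⟩ : ∃ y ∈ epsOptSet X G ε,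
      ‖x - y‖ ≤ A / ε * Metric.diam X + 2 * √(ε / ρ) := by
    -- Near `zb`, the move starts from `zb`. Far from it, the penalty is at least `2 * ε`, so `G x ≤
    -- G zb - ε` and the move can start from `x` itself.
    by_cases hr : ‖x - zb‖ ≤ 2 * √(ε / ρ)
    · obtain ⟨y, hy, hzy⟩ := exists_mem_epsOptSet_norm_sub_le hcpt hGconv hGcont hε hA0 hzbX hGzb
      refine ⟨y, hy, ?_⟩
      have := norm_sub_le_norm_sub_add_norm_sub x zb y
      linarith
    · push Not at hr
      have hsq : 4 * (ε / ρ) ≤ ‖x - zb‖ ^ 2 := by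
        have := pow_le_pow_left₀ (by positivity) hr.le 2
        rwa [mul_pow, Real.sq_sqrt (by positivity), show (2 : ℝ) ^ 2 = 4 by norm_num] at this
      have : 2 * ε ≤ ρ / 2 * ‖x - zb‖ ^ 2 := by
        calc 2 * ε = ρ / 2 * (4 * (ε / ρ)) := by field_simp; norm_num
          _ ≤ _ := mul_le_mul_of_nonneg_left hsq (by positivity)
      obtain ⟨y, hy, hxy⟩ := exists_mem_epsOptSet_norm_sub_le hcpt hGconv hGcont hε hA0 hx.1
        (by linarith)
      exact ⟨y, hy, hxy.trans (le_add_of_nonneg_right (by positivity))⟩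
  set δb := (1 / (m : ℝ)) * ∑ i, δ i with hδb
  have hδb0 : 0 ≤ δb := mul_nonneg (by positivity) (Finset.sum_nonneg fun i _ => hδ0 i)
  have hGf (y : E) (hy : y ∈ X) : |G y - f y| ≤ δb := by
    have : G y - f y = (1 / (m : ℝ)) * ∑ i, (g i y - f y) := by
      simp only [hG, Finset.sum_sub_distrib, Finset.sum_const, Finset.card_univ,
        Fintype.card_fin, nsmul_eq_mul]
      field_simp
    rw [this, abs_mul, abs_of_nonneg (by positivity : 0 ≤ 1 / (m : ℝ))]
    exact mul_le_mul_of_nonneg_left ((Finset.abs_sum_le_sum_abs _ _).trans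
      (Finset.sum_le_sum fun i _ => hδ i y hy)) (by positivity)
  obtain ⟨x₂, hx₂, -, hopt₂⟩ := exists_minimizer ⟨x, hx.1⟩ hcpt hfc
  -- The excess is `2 * δb`: `G` and `f` are exchanged once at `y₁` and once at the minimizer of
  -- `f`.
  obtain ⟨y₂, hy₂, hyy⟩ := exists_mem_epsOptSet_norm_sub_le hcpt hf hfc hε
    (by positivity : 0 ≤ 2 * δb) hy₁.1 (by
      have h1 := hy₁.2
      have h2 := optValue_le hcpt hGcont hx₂
      have h3 := (abs_le.1 (hGf _ hy₁.1)).1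
      have h4 := (abs_le.1 (hGf _ hx₂)).2
      linarith)
  refine ⟨y₂, hy₂, ?_⟩
  have h1 := norm_sub_le_norm_sub_add_norm_sub x y₁ y₂
  have h2 : (2 / (m : ℝ) * ∑ j, δ j + A) / ε * Metric.diam X
      = 2 * δb / ε * Metric.diam X + A / ε * Metric.diam X := by
    rw [hδb]; ring
  linarith

end Deterministic

/-! ### Measurability of the optimal value and of the pessimistic distance -/

/-- The positivity set of `u` is relatively open in `X`, so it meets every dense subset. With `D`
countable, this turns existence over `X` into a countable union. -/
lemma exists_pos_of_subset_closure {E : Type*} [TopologicalSpace E] {X D : Set E} (hDX : D ⊆ X)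
    (hD : X ⊆ closure D) {u : E → ℝ} (hu : ContinuousOn u X) :
    (∃ x ∈ X, 0 < u x) ↔ ∃ x ∈ D, 0 < u x := by
  refine ⟨fun ⟨x, hx, hux⟩ => ?_, fun ⟨x, hx, h⟩ => ⟨x, hDX hx, h⟩⟩
  obtain ⟨O, hO, hOX⟩ := continuousOn_iff'.1 hu (Set.Ioi 0) isOpen_Ioi
  have hxO : x ∈ O := (hOX.subset ⟨hux, hx⟩).1
  obtain ⟨y, hyO, hyD⟩ := mem_closure_iff.1 (hD hx) O hO hxO
  exact ⟨y, hyD, (hOX.symm.subset ⟨hyO, hDX hyD⟩).1⟩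

lemma measurable_optValue {E Ω : Type*} [PseudoMetricSpace E] [MeasurableSpace Ω] {X : Set E}
    (hne : X.Nonempty) (hcpt : IsCompact X) {h : Ω → E → ℝ}
    (hcont : ∀ ω, ContinuousOn (h ω) X) (hmeas : ∀ x ∈ X, Measurable fun ω => h ω x) :
    Measurable fun ω => optValue X (h ω) := by
  obtain ⟨D, hDX, hDc, hD⟩ := hcpt.isSeparable.exists_countable_dense_subset
  refine measurable_of_Iio fun c => ?_
  have : (fun ω => optValue X (h ω)) ⁻¹' Set.Iio c = ⋃ x ∈ D, {ω | h ω x < c} := by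
    ext ω
    simp only [Set.mem_preimage, Set.mem_Iio, Set.mem_iUnion, Set.mem_ofPred_eq, exists_prop]
    have := exists_pos_of_subset_closure hDX hD (u := fun x => c - h ω x)
      (continuousOn_const.sub (hcont ω))
    simp only [sub_pos] at this
    rw [← this]
    obtain ⟨x₀, hx₀, -, hopt⟩ := exists_minimizer hne hcpt (hcont ω)
    exact ⟨fun hlt => ⟨x₀, hx₀, hopt ▸ hlt⟩,
      fun ⟨x, hx, hlt⟩ => (optValue_le hcpt (hcont ω) hx).trans_lt hlt⟩
  rw [this]
  exact MeasurableSet.biUnion hDc fun x hx => (hmeas x (hDX hx)) measurableSet_Iio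

lemma pessimisticDist_eq {E : Type*} [NormedAddCommGroup E] (A B : Set E) :
    pessimisticDist A B = ⨆ a : A, Metric.infDist (a : E) B := by
  simp only [pessimisticDist, Metric.infDist_eq_iInf, dist_eq_norm]

/-- The strictly `ε`-optimal points of a convex function are dense in its `ε`-optimal set. -/
lemma exists_strict_of_mem_epsOptSet {E : Type*} [NormedAddCommGroup E] [NormedSpace ℝ E]
    {X : Set E} (hcpt : IsCompact X) {g φ : E → ℝ} (hconv : ConvexOn ℝ X g)
    (hcont : ContinuousOn g X) (hφ : Continuous φ) {ε : ℝ} (hε : 0 < ε) {c : ℝ} {x : E}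
    (hx : x ∈ epsOptSet X g ε) (hc : c < φ x) :
    ∃ y ∈ X, g y < optValue X g + ε ∧ c < φ y := by
  obtain ⟨x₀, hx₀, -, hopt⟩ := exists_minimizer ⟨x, hx.1⟩ hcpt hcont
  have hlim : Filter.Tendsto (fun t : ℝ => φ ((1 - t) • x + t • x₀)) (nhdsWithin 0 (Set.Ioi 0))
      (nhds (φ x)) := by
    refine Filter.Tendsto.mono_left ?_ nhdsWithin_le_nhds
    refine Continuous.tendsto' (by fun_prop) _ _ (by simp)
  have h1 := hlim.eventually (lt_mem_nhds hc)
  have h2 : ∀ᶠ t : ℝ in nhdsWithin 0 (Set.Ioi 0), t ∈ Set.Ioo (0 : ℝ) 1 :=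
    Ioo_mem_nhdsGT one_pos
  obtain ⟨t, ht1, ht0, ht⟩ := (h1.and h2).exists
  refine ⟨_, hconv.1 hx.1 hx₀ (by linarith) ht0.le (by ring), ?_, ht1⟩
  have h := hconv.2 hx.1 hx₀ (by linarith : 0 ≤ 1 - t) ht0.le (by ring)
  simp only [smul_eq_mul] at h
  have h3 : (1 - t) * g x ≤ (1 - t) * (g x₀ + ε) :=
    mul_le_mul_of_nonneg_left (hopt ▸ hx.2) (by linarith)
  -- The convex combination has value at most `g x₀ + ε - t * ε`, so `t * ε` is the strict slack.
  have h4 := mul_pos ht0 hε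
  rw [hopt]
  linarith

/-- The supremum runs over a random set. It exceeds `c` exactly when some strictly `ε`-optimal point
is farther than `c` from `B`; both conditions are relatively open in the point, so a countable dense
set of candidates is enough. -/
lemma measurable_pessimisticDist_epsOptSet {E Ω : Type*} [NormedAddCommGroup E]
    [NormedSpace ℝ E] [MeasurableSpace Ω] {X B : Set E} (hne : X.Nonempty) (hcpt : IsCompact X)
    {h : Ω → E → ℝ} (hconv : ∀ ω, ConvexOn ℝ X (h ω)) (hcont : ∀ ω, ContinuousOn (h ω) X)
    (hmeas : ∀ x ∈ X, Measurable fun ω => h ω x) {ε : ℝ} (hε : 0 < ε) :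
    Measurable fun ω => pessimisticDist (epsOptSet X (h ω) ε) B := by
  obtain ⟨D, hDX, hDc, hD⟩ := hcpt.isSeparable.exists_countable_dense_subset
  have hopt := measurable_optValue hne hcpt hcont hmeas
  refine measurable_of_Ioi fun c => ?_
  have hφ : Continuous fun x : E => Metric.infDist x B := Metric.continuous_infDist_pt B
  have : (fun ω => pessimisticDist (epsOptSet X (h ω) ε) B) ⁻¹' Set.Ioi c
      = ⋃ x ∈ D, {ω | h ω x < optValue X (h ω) + ε ∧ c < Metric.infDist x B} := by
    ext ω
    simp only [Set.mem_preimage, Set.mem_Ioi, Set.mem_iUnion, Set.mem_ofPred_eq, exists_prop]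
    have hd := exists_pos_of_subset_closure hDX hD
      (u := fun x => (optValue X (h ω) + ε - h ω x) ⊓ (Metric.infDist x B - c))
      (ContinuousOn.inf (continuousOn_const.sub (hcont ω)) (hφ.continuousOn.sub continuousOn_const))
    simp only [lt_inf_iff, sub_pos] at hd
    rw [← hd, pessimisticDist_eq]
    obtain ⟨x₀, hx₀, -, hx₀opt⟩ := exists_minimizer hne hcpt (hcont ω)
    have : Nonempty (epsOptSet X (h ω) ε) := ⟨⟨x₀, hx₀, by linarith⟩⟩
    have hbdd : BddAbove (Set.range fun a : epsOptSet X (h ω) ε => Metric.infDist (a : E) B) := by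
      refine (hcpt.bddAbove_image hφ.continuousOn).mono ?_
      rintro _ ⟨a, rfl⟩
      exact ⟨a, a.2.1, rfl⟩
    rw [lt_ciSup_iff hbdd]
    refine ⟨fun ⟨a, ha⟩ => exists_strict_of_mem_epsOptSet hcpt (hconv ω) (hcont ω) hφ hε a.2 ha,
      fun ⟨x, hx, h1, h2⟩ => ⟨⟨x, hx, h1.le⟩, h2⟩⟩
  rw [this]
  refine MeasurableSet.biUnion hDc fun x hx => ?_
  exact (measurableSet_lt (hmeas x (hDX hx)) (hopt.add_const ε)).inter
    (MeasurableSet.const _)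

/-! ### Regularity of the true and the sampled objectives -/

lemma continuousOn_of_holder {E : Type*} [NormedAddCommGroup E] {X : Set E} {g : E → ℝ}
    {L γ : ℝ} (hγ : 0 < γ) (h : ∀ x ∈ X, ∀ y ∈ X, |g x - g y| ≤ L * ‖x - y‖ ^ γ) :
    ContinuousOn g X := by
  intro x hx
  rw [ContinuousWithinAt, tendsto_iff_dist_tendsto_zero]
  have hlim : Filter.Tendsto (fun y => L * ‖y - x‖ ^ γ) (nhdsWithin x X) (nhds 0) := by
    refine Filter.Tendsto.mono_left ?_ nhdsWithin_le_nhds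
    refine Continuous.tendsto' ?_ _ _ (by simp [Real.zero_rpow hγ.ne'])
    exact continuous_const.mul ((by fun_prop : Continuous fun y : E => ‖y - x‖).rpow_const
      fun _ => Or.inr hγ.le)
  refine squeeze_zero' (Filter.Eventually.of_forall fun _ => dist_nonneg) ?_ hlim
  filter_upwards [self_mem_nhdsWithin] with y hy
  exact h y hy x hx

section Objectives

variable {E S : Type*} [NormedAddCommGroup E] [NormedSpace ℝ E] [MeasurableSpace S]
  {X : Set E} {F : E → S → ℝ} {ν : Measure S} [IsProbabilityMeasure ν] {L γ M : ℝ}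

omit [NormedAddCommGroup E] [NormedSpace ℝ E] in
lemma integrable_cost (hFmeas : ∀ x ∈ X, Measurable (F x))
    (hFbdd : ∀ x ∈ X, ∀ s, |F x s| ≤ M) {x : E} (hx : x ∈ X) : Integrable (F x) ν :=
  Integrable.of_bound (hFmeas x hx).aestronglyMeasurable M
    (Filter.Eventually.of_forall fun s => hFbdd x hx s)

omit [NormedSpace ℝ E] in
lemma abs_trueObj_sub_le (hFmeas : ∀ x ∈ X, Measurable (F x))
    (hFbdd : ∀ x ∈ X, ∀ s, |F x s| ≤ M)
    (hFhol : ∀ s, ∀ x ∈ X, ∀ y ∈ X, |F x s - F y s| ≤ L * ‖x - y‖ ^ γ)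
    (x : E) (hx : x ∈ X) (y : E) (hy : y ∈ X) :
    |trueObj F ν x - trueObj F ν y| ≤ L * ‖x - y‖ ^ γ := by
  rw [trueObj, trueObj, ← integral_sub (integrable_cost hFmeas hFbdd hx)
    (integrable_cost hFmeas hFbdd hy)]
  simpa using norm_integral_le_of_norm_le_const (μ := ν)
    (f := fun s => F x s - F y s) (C := L * ‖x - y‖ ^ γ) (Filter.Eventually.of_forall fun s => hFhol s x hx y hy)

lemma convexOn_trueObj (hX : Convex ℝ X) (hFmeas : ∀ x ∈ X, Measurable (F x))
    (hFbdd : ∀ x ∈ X, ∀ s, |F x s| ≤ M) (hFconv : ∀ s, ConvexOn ℝ X fun x => F x s) :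
    ConvexOn ℝ X (trueObj F ν) := by
  refine ⟨hX, fun x hx y hy a b ha hb hab => ?_⟩
  have hix := integrable_cost (ν := ν) hFmeas hFbdd hx
  have hiy := integrable_cost (ν := ν) hFmeas hFbdd hy
  simp only [trueObj, smul_eq_mul, ← integral_const_mul]
  rw [← integral_add (hix.const_mul a) (hiy.const_mul b)]
  exact integral_mono (integrable_cost hFmeas hFbdd (hX hx hy ha hb hab))
    ((hix.const_mul a).add (hiy.const_mul b)) fun s => (hFconv s).2 hx hy ha hb hab

omit [NormedSpace ℝ E] [MeasurableSpace S] in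
lemma abs_saaObj_sub_le {n : ℕ} (hn : 1 ≤ n)
    (hFhol : ∀ s, ∀ x ∈ X, ∀ y ∈ X, |F x s - F y s| ≤ L * ‖x - y‖ ^ γ) (s : Fin n → S)
    (x : E) (hx : x ∈ X) (y : E) (hy : y ∈ X) :
    |saaObj F s x - saaObj F s y| ≤ L * ‖x - y‖ ^ γ := by
  have hn0 : (n : ℝ) ≠ 0 := by positivity
  rw [saaObj, saaObj, ← mul_sub, ← Finset.sum_sub_distrib, abs_mul,
    abs_of_nonneg (by positivity : 0 ≤ 1 / (n : ℝ))]
  calc 1 / (n : ℝ) * |∑ j, (F x (s j) - F y (s j))|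
      ≤ 1 / (n : ℝ) * ∑ _j : Fin n, L * ‖x - y‖ ^ γ :=
        mul_le_mul_of_nonneg_left ((Finset.abs_sum_le_sum_abs _ _).trans
          (Finset.sum_le_sum fun j _ => hFhol _ x hx y hy)) (by positivity)
    _ = L * ‖x - y‖ ^ γ := by simp [hn0]

omit [MeasurableSpace S] in
lemma convexOn_saaObj {n : ℕ} (hX : Convex ℝ X) (hFconv : ∀ s, ConvexOn ℝ X fun x => F x s)
    (s : Fin n → S) : ConvexOn ℝ X (saaObj F s) :=
  convexOn_average hX fun j => hFconv (s j)

omit [NormedAddCommGroup E] [NormedSpace ℝ E] in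
lemma abs_saaObj_sub_trueObj_le_supError {n : ℕ} (hn : 1 ≤ n)
    (hFbdd : ∀ x ∈ X, ∀ s, |F x s| ≤ M) (s : Fin n → S) {x : E} (hx : x ∈ X) :
    |saaObj F s x - trueObj F ν x| ≤ supError X F ν s := by
  have hn0 : (n : ℝ) ≠ 0 := by positivity
  -- The bound `M + M` ensures that the real supremum is genuine and not the default value `0` of an
  -- unbounded family.
  refine le_ciSup (f := fun x : X => |saaObj F s x - trueObj F ν x|) ⟨M + M, ?_⟩ ⟨x, hx⟩
  rintro _ ⟨y, rfl⟩
  refine (abs_sub _ _).trans (add_le_add ?_ ?_)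
  · rw [saaObj, abs_mul, abs_of_nonneg (by positivity : 0 ≤ 1 / (n : ℝ))]
    calc 1 / (n : ℝ) * |∑ j, F y (s j)| ≤ 1 / (n : ℝ) * ∑ _j : Fin n, M :=
        mul_le_mul_of_nonneg_left ((Finset.abs_sum_le_sum_abs _ _).trans
          (Finset.sum_le_sum fun j _ => hFbdd y y.2 _)) (by positivity)
      _ = M := by simp [hn0]
  · simpa [trueObj] using norm_integral_le_of_norm_le_const (μ := ν) (f := F y) (C := M)
      (Filter.Eventually.of_forall fun s => hFbdd y y.2 s)

end Objectives

/-! ### Finite nets in a cube -/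

lemma exists_cell {c D : ℝ} {k : ℕ} (hk : 0 < k) {u : ℝ} (hu : u ∈ Set.Icc c (c + D)) :
    ∃ j : Fin k, c + j * (D / k) ≤ u ∧ u ≤ c + (j + 1) * (D / k) := by
  have hk' : (k : ℝ) ≠ 0 := by positivity
  -- Descend from the top cell until the lower endpoint is at most `u`; the descent ends because `c
  -- ≤ u`.
  have key : ∀ l : ℕ, l ≤ k → u ≤ c + l * (D / k) → 0 < l →
      ∃ j : ℕ, j < k ∧ c + j * (D / k) ≤ u ∧ u ≤ c + (j + 1) * (D / k) := by
    intro l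
    induction l with
    | zero => intro _ _ h; exact absurd h (lt_irrefl _)
    | succ l ih =>
      intro hl hul _
      push_cast at hul
      by_cases h : c + l * (D / k) ≤ u
      · exact ⟨l, hl, h, hul⟩
      · rcases Nat.eq_zero_or_pos l with rfl | hl0
        · simp only [Nat.cast_zero, zero_mul, add_zero] at h
          exact absurd hu.1 h
        · exact ih (Nat.le_of_succ_le hl) (not_le.1 h).le hl0
  obtain ⟨j, hj, h⟩ := key k le_rfl (by rw [mul_div_cancel₀ _ hk']; exact hu.2) hk
  exact ⟨⟨j, hj⟩, h⟩

/-- A set in a cube with edge length `D` has a net of `k ^ p` of its points, of mesh `√p D / k`. -/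
lemma exists_net {p : ℕ} {X : Set (EuclideanSpace ℝ (Fin p))} (hne : X.Nonempty) {D : ℝ}
    (hD : 0 ≤ D) (hX : InCube X D) {k : ℕ} (hk : 0 < k) :
    ∃ y : (Fin p → Fin k) → EuclideanSpace ℝ (Fin p), (∀ q, y q ∈ X) ∧
      ∀ x ∈ X, ∃ q, ‖x - y q‖ ≤ √p * D / k := by
  classical
  obtain ⟨b, c, hbc⟩ := hX
  have hcell : ∀ x : X, ∃ q : Fin p → Fin k, ∀ i,
      c i + (q i : ℕ) * (D / k) ≤ b.repr x i ∧ b.repr x i ≤ c i + ((q i : ℕ) + 1) * (D / k) := by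
    intro x
    choose q hq using fun i => exists_cell hk (hbc x x.2 i)
    exact ⟨q, hq⟩
  choose cell hcell using hcell
  obtain ⟨x₀, hx₀⟩ := hne
  -- Each occupied cell is represented by one of its points in `X`, not by its centre, because `F`
  -- is controlled only on `X`. Empty cells receive the dummy `x₀`.
  refine ⟨fun q => if h : ∃ x : X, cell x = q then (h.choose : EuclideanSpace ℝ (Fin p)) else x₀,
    fun q => ?_, fun x hx => ⟨cell ⟨x, hx⟩, ?_⟩⟩
  · dsimp only
    split_ifs with h
    exacts [h.choose.2, hx₀]
  · have hex : ∃ x' : X, cell x' = cell ⟨x, hx⟩ := ⟨_, rfl⟩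
    dsimp only
    rw [dif_pos hex]
    have hy := hcell hex.choose
    rw [hex.choose_spec] at hy
    have hxc := hcell ⟨x, hx⟩
    rw [← b.repr.norm_map, EuclideanSpace.norm_eq]
    have hle : ∑ i, ‖b.repr (x - hex.choose) i‖ ^ 2 ≤ ∑ _i : Fin p, (D / k) ^ 2 := by
      refine Finset.sum_le_sum fun i _ => pow_le_pow_left₀ (norm_nonneg _) ?_ 2
      rw [map_sub, PiLp.sub_apply, Real.norm_eq_abs, abs_le]
      have h1 := hy i
      have h2 := hxc i
      constructor <;> linarith
    refine (Real.sqrt_le_sqrt hle).trans_eq ?_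
    rw [Finset.sum_const, Finset.card_univ, Fintype.card_fin, nsmul_eq_mul,
      Real.sqrt_mul (by positivity), Real.sqrt_sq (by positivity), mul_div_assoc]

/-! ### Sub-Gaussian sample means and maximal inequalities -/

section SubGaussian

variable {Ω : Type*} [MeasurableSpace Ω] {P : Measure Ω} [IsProbabilityMeasure P]

/-- Hoeffding's lemma on `[-M, M]` gives each centred term the proxy `M ^ 2`; independence adds the
`n` proxies and the factor `1 / n` enters squared. -/
lemma hasSubgaussianMGF_sampleMean {S : Type*} [MeasurableSpace S] {ν : Measure S} {n : ℕ}
    (hn : 1 ≤ n) {φ : S → ℝ} (hφ : Measurable φ) {M : ℝ} (hM : 0 ≤ M) (hφM : ∀ s, |φ s| ≤ M)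
    {ζ : Fin n → Ω → S} (hζ : ∀ j, Measurable (ζ j)) (hlaw : ∀ j, P.map (ζ j) = ν)
    (hindep : iIndepFun ζ P) :
    HasSubgaussianMGF (fun ω => (1 / (n : ℝ)) * ∑ j, φ (ζ j ω) - ∫ s, φ s ∂ν)
      (Real.toNNReal (M ^ 2 / n)) P := by
  have hn0 : (n : ℝ) ≠ 0 := by positivity
  have hint (j : Fin n) : ∫ ω, φ (ζ j ω) ∂P = ∫ s, φ s ∂ν := by
    rw [← hlaw j, integral_map (hζ j).aemeasurable hφ.aestronglyMeasurable]
  have hj (j : Fin n) : HasSubgaussianMGF (fun ω => φ (ζ j ω) - ∫ s, φ s ∂ν)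
      ((‖M - -M‖₊ / 2) ^ 2) P := by
    rw [← hint j]
    exact hasSubgaussianMGF_of_mem_Icc (hφ.comp (hζ j)).aemeasurable
      (Filter.Eventually.of_forall fun ω => abs_le.1 (hφM _))
  have hind : iIndepFun (fun j ω => φ (ζ j ω) - ∫ s, φ s ∂ν) P :=
    hindep.comp (fun _ s => φ s - ∫ s, φ s ∂ν) fun _ => hφ.sub_const _
  have h := (HasSubgaussianMGF.sum_of_iIndepFun hind (s := Finset.univ)
    fun j _ => hj j).const_mul (1 / (n : ℝ))
  convert h using 1
  · ext ω
    rw [Finset.sum_sub_distrib, Finset.sum_const, Finset.card_univ, Fintype.card_fin,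
      nsmul_eq_mul]
    field_simp
  · ext
    rw [Real.coe_toNNReal _ (by positivity)]
    change M ^ 2 / n = (1 / (n : ℝ)) ^ 2
      * ((∑ _j : Fin n, (‖M - -M‖₊ / 2) ^ 2 : NNReal) : ℝ)
    push_cast
    rw [Finset.sum_const, Finset.card_univ, Fintype.card_fin, nsmul_eq_mul, sub_neg_eq_add,
      Real.norm_of_nonneg (by positivity)]
    field_simp
    ring

/-- Maximal inequality for finitely many sub-Gaussian variables, with an explicit majorant. -/
lemma exists_integrable_majorant {ι : Type*} [Fintype ι] [Nonempty ι] {Y : ι → Ω → ℝ} {c : ℝ}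
    (hc : 0 < c) (hY : ∀ q, HasSubgaussianMGF (Y q) (Real.toNNReal c) P) {b : ℝ} (hb : 0 < b)
    (hcb : 2 * c * Real.log (2 * Fintype.card ι) ≤ b ^ 2) :
    ∃ G : Ω → ℝ, Integrable G P ∧ (∀ q ω, |Y q ω| ≤ G ω) ∧ ∫ ω, G ω ∂P ≤ b := by
  -- With this `t`, the bound `a / t` on the integral is `c * log (2 K) / b + b / 2`, `K` being the
  -- cardinality of `ι`, and `hcb` makes the first summand at most `b / 2`.
  set t := b / c with ht
  have ht0 : 0 < t := by positivity
  set a := Real.log (2 * Fintype.card ι) + c * t ^ 2 / 2 with ha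
  have hK : (0 : ℝ) < Fintype.card ι := by exact_mod_cast Fintype.card_pos
  set T : Ω → ℝ := fun ω => ∑ q, (Real.exp (t * Y q ω) + Real.exp (-t * Y q ω)) with hT
  have hint (q : ι) : Integrable (fun ω => Real.exp (t * Y q ω) + Real.exp (-t * Y q ω)) P :=
    ((hY q).integrable_exp_mul t).add ((hY q).integrable_exp_mul (-t))
  have hTi : Integrable T P := integrable_finsetSum _ fun q _ => hint q
  have hTint : ∫ ω, T ω ∂P ≤ Real.exp a := by
    rw [hT, integral_finsetSum _ fun q _ => hint q]
    have hq (q : ι) : ∫ ω, (Real.exp (t * Y q ω) + Real.exp (-t * Y q ω)) ∂P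
        ≤ 2 * Real.exp (c * t ^ 2 / 2) := by
      rw [integral_add ((hY q).integrable_exp_mul t) ((hY q).integrable_exp_mul (-t))]
      have h1 := (hY q).mgf_le t
      have h2 := (hY q).mgf_le (-t)
      rw [Real.coe_toNNReal _ hc.le] at h1 h2
      rw [neg_sq] at h2
      simp only [mgf] at h1 h2
      linarith
    refine (Finset.sum_le_sum fun q _ => hq q).trans_eq ?_
    rw [Finset.sum_const, Finset.card_univ, nsmul_eq_mul, ha, Real.exp_add,
      Real.exp_log (by positivity)]
    ring
  refine ⟨fun ω => (1 / t) * (a - 1 + Real.exp (-a) * T ω),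
    ((integrable_const _).add (hTi.const_mul _)).const_mul _, fun q ω => ?_, ?_⟩
  · have hexp : Real.exp (t * |Y q ω|) ≤ T ω := by
      refine le_trans ?_ (Finset.single_le_sum
        (f := fun q => Real.exp (t * Y q ω) + Real.exp (-t * Y q ω))
        (fun q _ => by positivity) (Finset.mem_univ q))
      rcases abs_cases (Y q ω) with ⟨h, -⟩ | ⟨h, -⟩ <;> rw [h]
      · exact le_add_of_nonneg_right (Real.exp_pos _).le
      · rw [mul_neg, ← neg_mul]
        exact le_add_of_nonneg_left (Real.exp_pos _).le
    -- The tangent line of the exponential at `0` replaces Jensen's inequality for the logarithm and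
    -- yields a majorant affine in `T`.
    have h1 := Real.add_one_le_exp (t * |Y q ω| - a)
    have h2 : Real.exp (t * |Y q ω| - a) ≤ Real.exp (-a) * T ω := by
      rw [sub_eq_add_neg, Real.exp_add, mul_comm]
      exact mul_le_mul_of_nonneg_left hexp (Real.exp_pos _).le
    dsimp only
    rw [one_div, inv_mul_eq_div, le_div_iff₀ ht0]
    linarith
  · rw [integral_const_mul, integral_add (integrable_const _) (hTi.const_mul _),
      integral_const_mul]
    simp only [integral_const, probReal_univ, one_smul]
    have h1 : Real.exp (-a) * ∫ ω, T ω ∂P ≤ 1 := by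
      refine (mul_le_mul_of_nonneg_left hTint (Real.exp_pos _).le).trans_eq ?_
      rw [← Real.exp_add]; simp
    rw [one_div, inv_mul_eq_div, div_le_iff₀ ht0]
    have h2 : b * t = b ^ 2 / c := by rw [ht]; ring
    have h3 : c * t ^ 2 / 2 = b ^ 2 / (2 * c) := by rw [ht]; field_simp
    have h4 : Real.log (2 * Fintype.card ι) ≤ b ^ 2 / (2 * c) := by
      rw [le_div_iff₀ (by positivity)]; linarith
    have h5 : b ^ 2 / c = b ^ 2 / (2 * c) + b ^ 2 / (2 * c) := by field_simp; ring
    linarith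

lemma measureReal_exists_abs_ge_le {ι : Type*} [Fintype ι] {Y : ι → Ω → ℝ} {c : ℝ}
    (hc : 0 ≤ c) (hY : ∀ q, HasSubgaussianMGF (Y q) (Real.toNNReal c) P) {w : ℝ} (hw : 0 ≤ w) :
    P.real {ω | ∃ q, w ≤ |Y q ω|} ≤ 2 * Fintype.card ι * Real.exp (-w ^ 2 / (2 * c)) := by
  have hsub : {ω | ∃ q, w ≤ |Y q ω|} ⊆ ⋃ q, ({ω | w ≤ Y q ω} ∪ {ω | w ≤ (-Y q) ω}) := by
    rintro ω ⟨q, hq⟩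
    refine Set.mem_iUnion.2 ⟨q, ?_⟩
    exact le_abs.1 hq
  refine (measureReal_mono hsub).trans ((measureReal_iUnion_fintype_le _).trans ?_)
  have hq (q : ι) : P.real ({ω | w ≤ Y q ω} ∪ {ω | w ≤ (-Y q) ω})
      ≤ 2 * Real.exp (-w ^ 2 / (2 * c)) := by
    have h1 := (hY q).measure_ge_le hw
    have h2 := (hY q).neg.measure_ge_le hw
    rw [Real.coe_toNNReal _ hc] at h1 h2
    have h3 := measureReal_union_le (μ := P) {ω | w ≤ Y q ω} {ω | w ≤ (-Y q) ω}
    linarith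
  refine (Finset.sum_le_sum fun q _ => hq q).trans_eq ?_
  rw [Finset.sum_const, Finset.card_univ, nsmul_eq_mul]
  ring

end SubGaussian

/-! ### Grid size and the constants of the rate -/

/-- This is `log u ≤ u - 1` at `u = x ^ α / e`. With `α = 1 - 2 * lam` it is the source of the last
denominator in `constNF`. -/
lemma log_le_rpow_div_mul_exp {x α : ℝ} (hx : 0 < x) (hα : 0 < α) :
    Real.log x ≤ x ^ α / (α * Real.exp 1) := by
  have h := Real.log_le_sub_one_of_pos (div_pos (Real.rpow_pos_of_pos hx α) (Real.exp_pos 1))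
  rw [Real.log_div (Real.rpow_pos_of_pos hx α).ne' (Real.exp_pos 1).ne', Real.log_exp,
    Real.log_rpow hx] at h
  rw [le_div_iff₀ (by positivity)]
  have h2 : α * Real.log x ≤ x ^ α / Real.exp 1 := by linarith
  rw [le_div_iff₀ (Real.exp_pos 1)] at h2
  linarith

/-- The number of grid subdivisions per edge, a power of the sample size. -/
noncomputable def gridSize (γ : ℝ) (n : ℕ) : ℕ := n ^ ⌈1 / γ⌉₊

lemma gridSize_pos (γ : ℝ) {n : ℕ} (hn : 1 ≤ n) : 0 < gridSize γ n :=
  pow_pos hn _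

lemma log_gridSize_le {γ : ℝ} (hγ0 : 0 < γ) (hγ1 : γ ≤ 1) {n : ℕ} (hn : 1 ≤ n) :
    Real.log (gridSize γ n) ≤ 2 / γ * Real.log n := by
  rw [gridSize, Nat.cast_pow, Real.log_pow]
  refine mul_le_mul_of_nonneg_right ?_ (Real.log_nonneg (by exact_mod_cast hn))
  have h1 := (Nat.ceil_lt_add_one (by positivity : 0 ≤ 1 / γ)).le
  -- Since `γ ≤ 1`, the rounding error of the ceiling is at most `1 / γ`, whence the factor `2 / γ`.
  have h2 : 1 ≤ 1 / γ := (one_le_div hγ0).2 hγ1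
  have h3 : 2 / γ = 1 / γ + 1 / γ := by ring
  linarith

lemma rpow_le_gridSize_rpow {γ : ℝ} (hγ0 : 0 < γ) {n : ℕ} (hn : 1 ≤ n) {lam : ℝ}
    (hlam : lam ≤ 1) : (n : ℝ) ^ lam ≤ (gridSize γ n : ℝ) ^ γ := by
  have hn1 : (1 : ℝ) ≤ n := by exact_mod_cast hn
  rw [gridSize, Nat.cast_pow, ← Real.rpow_natCast, ← Real.rpow_mul (by positivity)]
  refine Real.rpow_le_rpow_of_exponent_le hn1 (hlam.trans ?_)
  rw [← div_le_iff₀ hγ0]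
  exact Nat.le_ceil _

/-- The part of `constNF` that controls the deviations over the net. -/
noncomputable def devConst (p : ℕ) (γ M lam : ℝ) : ℝ :=
  M * √(2 * Real.log 2) + M * √(p : ℝ) / √(γ * (1 - 2 * lam) * Real.exp 1)

lemma devConst_pos {p : ℕ} {γ M lam : ℝ} (hM : 0 < M) : 0 < devConst p γ M lam := by
  have : 0 < Real.log 2 := Real.log_pos (by norm_num)
  unfold devConst
  positivity

lemma constNF_eq (p : ℕ) (D L γ M lam : ℝ) :
    constNF p D L γ M lam = L * D ^ γ * (p : ℝ) ^ (γ / 2) + devConst p γ M lam := by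
  rw [constNF, devConst, add_assoc]

/-- This is the hypothesis `hcb` of `exists_integrable_majorant` for the net with `gridSize γ n`
cells per edge. Both `log 2` and the logarithm of the grid size are bounded by multiples of `n ^ (1
- 2 * lam) = n * w`, and the factor `n` cancels against the proxy. -/
lemma log_card_net_le {p n : ℕ} {γ M lam : ℝ} (hγ0 : 0 < γ) (hγ1 : γ ≤ 1) (hM : 0 < M)
    (hn : 1 ≤ n) (hlam1 : lam < 1 / 2) :
    2 * (M ^ 2 / n) * Real.log (2 * (gridSize γ n : ℝ) ^ p)
      ≤ (2 * devConst p γ M lam * (n : ℝ) ^ (-lam)) ^ 2 := by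
  have hn0 : (0 : ℝ) < n := by exact_mod_cast hn
  have hn1 : (1 : ℝ) ≤ n := by exact_mod_cast hn
  have hlog2 : 0 < Real.log 2 := Real.log_pos (by norm_num)
  have hα : 0 < 1 - 2 * lam := by linarith
  set w := ((n : ℝ) ^ (-lam)) ^ 2 with hw
  have hw' : w = (n : ℝ) ^ (-(2 * lam)) := by
    rw [hw, ← Real.rpow_natCast, ← Real.rpow_mul hn0.le]; push_cast; ring_nf
  have hw0 : 0 < w := by positivity
  have hnw : (n : ℝ) ^ (1 - 2 * lam) = n * w := by
    rw [hw', sub_eq_add_neg, Real.rpow_add hn0, Real.rpow_one]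
  have hnw1 : 1 ≤ n * w := hnw ▸ Real.one_le_rpow hn1 hα.le
  set κ := γ * (1 - 2 * lam) * Real.exp 1 with hκ
  have hκ0 : 0 < κ := by positivity
  have hgrid : (0 : ℝ) < gridSize γ n := by exact_mod_cast gridSize_pos γ hn
  have hlog : Real.log (2 * (gridSize γ n : ℝ) ^ p) ≤ Real.log 2 + 2 * p * (n * w) / κ := by
    rw [Real.log_mul (by norm_num) (by positivity), Real.log_pow]
    have h1 := log_gridSize_le hγ0 hγ1 hn
    have h2 := log_le_rpow_div_mul_exp hn0 hα
    rw [hnw] at h2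
    have h3 : Real.log (gridSize γ n) ≤ 2 / γ * (n * w / ((1 - 2 * lam) * Real.exp 1)) :=
      h1.trans (mul_le_mul_of_nonneg_left h2 (by positivity))
    have h4 := mul_le_mul_of_nonneg_left h3 (Nat.cast_nonneg (α := ℝ) p)
    have h5 : (p : ℝ) * (2 / γ * (n * w / ((1 - 2 * lam) * Real.exp 1)))
        = 2 * p * (n * w) / κ := by rw [hκ]; field_simp
    linarith
  have hdev : M ^ 2 * (2 * Real.log 2 + p / κ) ≤ devConst p γ M lam ^ 2 := by
    have e1 : (M * √(2 * Real.log 2)) ^ 2 = M ^ 2 * (2 * Real.log 2) := by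
      rw [mul_pow, Real.sq_sqrt (by positivity)]
    have e2 : (M * √(p : ℝ) / √κ) ^ 2 = M ^ 2 * (p / κ) := by
      rw [div_pow, mul_pow, Real.sq_sqrt (by positivity), Real.sq_sqrt hκ0.le, mul_div_assoc]
    have e3 : 0 ≤ (M * √(2 * Real.log 2)) * (M * √(p : ℝ) / √κ) := by positivity
    have e4 : devConst p γ M lam = M * √(2 * Real.log 2) + M * √(p : ℝ) / √κ := rfl
    rw [e4, add_sq, e1, e2]
    linarith
  calc 2 * (M ^ 2 / n) * Real.log (2 * (gridSize γ n : ℝ) ^ p)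
      ≤ 2 * (M ^ 2 / n) * (Real.log 2 + 2 * p * (n * w) / κ) :=
        mul_le_mul_of_nonneg_left hlog (by positivity)
    _ ≤ 2 * (M ^ 2 / n) * (Real.log 2 * (n * w) + 2 * p * (n * w) / κ) := by
        gcongr
        exact le_mul_of_one_le_right hlog2.le hnw1
    _ = (M ^ 2 * (2 * Real.log 2 + 4 * (p / κ))) * w := by field_simp; ring
    _ ≤ (4 * (M ^ 2 * (2 * Real.log 2 + p / κ))) * w := by
        refine mul_le_mul_of_nonneg_right ?_ hw0.le
        have : 0 ≤ M ^ 2 * Real.log 2 := by positivity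
        linarith
    _ ≤ (4 * devConst p γ M lam ^ 2) * w := by gcongr
    _ = _ := by rw [hw]; ring

lemma one_le_mul_rpow_neg_sq {n : ℕ} (hn : 1 ≤ n) {lam : ℝ} (hlam1 : lam < 1 / 2) :
    1 ≤ (n : ℝ) * ((n : ℝ) ^ (-lam)) ^ 2 := by
  have hn0 : (0 : ℝ) < n := by exact_mod_cast hn
  have hn1 : (1 : ℝ) ≤ n := by exact_mod_cast hn
  have : (n : ℝ) * ((n : ℝ) ^ (-lam)) ^ 2 = (n : ℝ) ^ (1 - 2 * lam) := by
    rw [← Real.rpow_natCast ((n : ℝ) ^ (-lam)), ← Real.rpow_mul hn0.le]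
    nth_rewrite 1 [← Real.rpow_one (n : ℝ)]
    rw [← Real.rpow_add hn0]
    congr 1
    push_cast
    ring
  rw [this]
  exact Real.one_le_rpow hn1 (by linarith)

lemma mesh_rpow_le {p n : ℕ} {D L γ lam : ℝ} (hD : 0 ≤ D) (hL : 0 ≤ L) (hγ0 : 0 < γ)
    (hn : 1 ≤ n) (hlam1 : lam < 1 / 2) :
    L * (√p * D / gridSize γ n) ^ γ ≤ L * D ^ γ * (p : ℝ) ^ (γ / 2) * (n : ℝ) ^ (-lam) := by
  have hn0 : (0 : ℝ) < n := by exact_mod_cast hn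
  have hsqrt : (√(p : ℝ)) ^ γ = (p : ℝ) ^ (γ / 2) := by
    rw [Real.sqrt_eq_rpow, ← Real.rpow_mul (by positivity)]
    congr 1
    ring
  have hgrid := rpow_le_gridSize_rpow (lam := lam) hγ0 hn (by linarith)
  have hD' : 0 ≤ D ^ γ := by positivity
  calc L * (√p * D / gridSize γ n) ^ γ
      = L * ((p : ℝ) ^ (γ / 2) * D ^ γ / (gridSize γ n : ℝ) ^ γ) := by
        rw [Real.div_rpow (by positivity) (by positivity), Real.mul_rpow (by positivity) hD, hsqrt]
    _ ≤ L * ((p : ℝ) ^ (γ / 2) * D ^ γ / (n : ℝ) ^ lam) :=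
        mul_le_mul_of_nonneg_left
          (div_le_div_of_nonneg_left (by positivity) (by positivity) hgrid) hL
    _ = _ := by rw [Real.rpow_neg hn0.le]; ring

/-! ### Uniform sampling error of one replication -/

section UniformDeviation

variable {p n : ℕ} {X : Set (EuclideanSpace ℝ (Fin p))} {S Ω : Type*} [MeasurableSpace S]
  [MeasurableSpace Ω] {F : EuclideanSpace ℝ (Fin p) → S → ℝ} {ν : Measure S}
  [IsProbabilityMeasure ν] {P : Measure Ω} [IsProbabilityMeasure P] {D L γ M lam : ℝ}
  {ζ : Fin n → Ω → S}

/-- The uniform sampling error is controlled by the sampling errors at the points of a net. -/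
lemma exists_deviation_family (hne : X.Nonempty) (hD : 0 ≤ D) (hcube : InCube X D)
    (hFmeas : ∀ x ∈ X, Measurable (F x)) (hL : 0 ≤ L) (hγ0 : 0 < γ)
    (hFhol : ∀ s, ∀ x ∈ X, ∀ y ∈ X, |F x s - F y s| ≤ L * ‖x - y‖ ^ γ)
    (hM : 0 < M) (hFbdd : ∀ x ∈ X, ∀ s, |F x s| ≤ M) (hn : 1 ≤ n) (hlam1 : lam < 1 / 2)
    (hζ : ∀ j, Measurable (ζ j)) (hlaw : ∀ j, P.map (ζ j) = ν) (hindep : iIndepFun ζ P) :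
    ∃ Y : (Fin p → Fin (gridSize γ n)) → Ω → ℝ,
      (∀ q, HasSubgaussianMGF (Y q) (Real.toNNReal (M ^ 2 / n)) P) ∧
      ∀ ω c, (∀ q, |Y q ω| ≤ c) → supError X F ν (fun j => ζ j ω)
        ≤ 2 * (L * D ^ γ * (p : ℝ) ^ (γ / 2)) * (n : ℝ) ^ (-lam) + c := by
  obtain ⟨y, hyX, hy⟩ := exists_net hne hD hcube (gridSize_pos γ hn)
  refine ⟨fun q ω => saaObj F (fun j => ζ j ω) (y q) - trueObj F ν (y q), fun q =>
    hasSubgaussianMGF_sampleMean hn (hFmeas _ (hyX q)) hM.le (hFbdd _ (hyX q)) hζ hlaw hindep,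
    fun ω c hc => ?_⟩
  have : Nonempty X := hne.to_subtype
  refine ciSup_le fun x => ?_
  obtain ⟨q, hq⟩ := hy x x.2
  have hmesh : L * ‖(x : EuclideanSpace ℝ (Fin p)) - y q‖ ^ γ
      ≤ L * D ^ γ * (p : ℝ) ^ (γ / 2) * (n : ℝ) ^ (-lam) :=
    (mul_le_mul_of_nonneg_left (Real.rpow_le_rpow (norm_nonneg _) hq hγ0.le) hL).trans
      (mesh_rpow_le hD hL hγ0 hn hlam1)
  -- The mesh error is paid twice, for the sampled and for the true objective.
  have h1 := abs_le.1 ((abs_saaObj_sub_le hn hFhol (fun j => ζ j ω) x x.2 _ (hyX q)).trans hmesh)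
  have h2 := abs_le.1
    ((abs_trueObj_sub_le (ν := ν) hFmeas hFbdd hFhol x x.2 _ (hyX q)).trans hmesh)
  have h3 := abs_le.1 (hc q)
  rw [abs_le]
  constructor <;> linarith [h1.1, h1.2, h2.1, h2.2, h3.1, h3.2]

lemma exists_supError_majorant (hne : X.Nonempty) (hD : 0 ≤ D) (hcube : InCube X D)
    (hFmeas : ∀ x ∈ X, Measurable (F x)) (hL : 0 ≤ L) (hγ0 : 0 < γ) (hγ1 : γ ≤ 1)
    (hFhol : ∀ s, ∀ x ∈ X, ∀ y ∈ X, |F x s - F y s| ≤ L * ‖x - y‖ ^ γ)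
    (hM : 0 < M) (hFbdd : ∀ x ∈ X, ∀ s, |F x s| ≤ M) (hn : 1 ≤ n) (hlam1 : lam < 1 / 2)
    (hζ : ∀ j, Measurable (ζ j)) (hlaw : ∀ j, P.map (ζ j) = ν) (hindep : iIndepFun ζ P) :
    ∃ G : Ω → ℝ, Integrable G P ∧ (∀ ω, supError X F ν (fun j => ζ j ω) ≤ G ω) ∧
      ∫ ω, G ω ∂P ≤ 2 * constNF p D L γ M lam * (n : ℝ) ^ (-lam) := by
  have hn0 : (0 : ℝ) < n := by exact_mod_cast hn
  obtain ⟨Y, hY, hYsup⟩ := exists_deviation_family (lam := lam) hne hD hcube hFmeas hL hγ0 hFhol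
    hM hFbdd hn hlam1 hζ hlaw hindep
  have hB := devConst_pos (p := p) (γ := γ) (lam := lam) hM
  have : Nonempty (Fin (gridSize γ n)) := ⟨⟨0, gridSize_pos γ hn⟩⟩
  obtain ⟨G, hGi, hG, hGint⟩ := exists_integrable_majorant (by positivity) hY
    (by positivity : 0 < 2 * devConst p γ M lam * (n : ℝ) ^ (-lam))
    (by simpa using log_card_net_le hγ0 hγ1 hM hn hlam1)
  refine ⟨fun ω => 2 * (L * D ^ γ * (p : ℝ) ^ (γ / 2)) * (n : ℝ) ^ (-lam) + G ω,
    (integrable_const _).add hGi, fun ω => hYsup ω _ fun q => hG q ω, ?_⟩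
  rw [integral_add (integrable_const _) hGi]
  simp only [integral_const, probReal_univ, one_smul]
  rw [constNF_eq]
  linarith

lemma measureReal_supError_ge_le (hne : X.Nonempty) (hD : 0 ≤ D) (hcube : InCube X D)
    (hFmeas : ∀ x ∈ X, Measurable (F x)) (hL : 0 ≤ L) (hγ0 : 0 < γ) (hγ1 : γ ≤ 1)
    (hFhol : ∀ s, ∀ x ∈ X, ∀ y ∈ X, |F x s - F y s| ≤ L * ‖x - y‖ ^ γ)
    (hM : 0 < M) (hFbdd : ∀ x ∈ X, ∀ s, |F x s| ≤ M) (hn : 1 ≤ n) (hlam1 : lam < 1 / 2)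
    (hζ : ∀ j, Measurable (ζ j)) (hlaw : ∀ j, P.map (ζ j) = ν) (hindep : iIndepFun ζ P)
    {τ : ℝ} (hτ : 0 ≤ τ) :
    P.real {ω | 2 * constNF p D L γ M lam + τ
        ≤ (n : ℝ) ^ lam * supError X F ν (fun j => ζ j ω)}
      ≤ Real.exp (-τ ^ 2 / (2 * M ^ 2)) := by
  have hn0 : (0 : ℝ) < n := by exact_mod_cast hn
  obtain ⟨Y, hY, hYsup⟩ := exists_deviation_family (lam := lam) hne hD hcube hFmeas hL hγ0 hFhol
    hM hFbdd hn hlam1 hζ hlaw hindep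
  have hB := devConst_pos (p := p) (γ := γ) (lam := lam) hM
  set B := devConst p γ M lam with hBdef
  set v := (n : ℝ) ^ (-lam) with hv
  have hv0 : 0 < v := by positivity
  have hnv : (n : ℝ) ^ lam * v = 1 := by
    rw [hv, ← Real.rpow_add hn0, add_neg_cancel, Real.rpow_zero]
  have : Nonempty (Fin (gridSize γ n)) := ⟨⟨0, gridSize_pos γ hn⟩⟩
  have hsub : {ω | 2 * constNF p D L γ M lam + τ
      ≤ (n : ℝ) ^ lam * supError X F ν (fun j => ζ j ω)} ⊆ {ω | ∃ q, (2 * B + τ) * v ≤ |Y q ω|} := by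
    intro ω hω
    by_contra hcon
    simp only [Set.mem_ofPred_eq, not_exists, not_le] at hcon hω
    -- Taking `c` to be the largest deviation keeps the inequality strict, although `hYsup` is a
    -- weak one.
    obtain ⟨q₀, hq₀⟩ := Finite.exists_max fun q => |Y q ω|
    have h1 := (hYsup ω _ hq₀).trans_lt (add_lt_add_right (hcon q₀) _)
    have h2 := mul_lt_mul_of_pos_left h1 (Real.rpow_pos_of_pos hn0 lam)
    have h3 : (n : ℝ) ^ lam * (2 * (L * D ^ γ * (p : ℝ) ^ (γ / 2)) * v + (2 * B + τ) * v)
        = (2 * (L * D ^ γ * (p : ℝ) ^ (γ / 2)) + (2 * B + τ)) * ((n : ℝ) ^ lam * v) := by ring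
    rw [h3, hnv] at h2
    rw [constNF_eq] at hω
    linarith
  refine (measureReal_mono hsub).trans ((measureReal_exists_abs_ge_le (by positivity) hY
    (by positivity)).trans ?_)
  have hK : (0 : ℝ) < 2 * Fintype.card (Fin p → Fin (gridSize γ n)) := by
    have : 0 < Fintype.card (Fin p → Fin (gridSize γ n)) := Fintype.card_pos
    positivity
  rw [← Real.exp_log hK, ← Real.exp_add, Real.exp_le_exp]
  have hlog : 2 * (M ^ 2 / n) * Real.log (2 * Fintype.card (Fin p → Fin (gridSize γ n)))
      ≤ (2 * B * v) ^ 2 := by simpa using log_card_net_le hγ0 hγ1 hM hn hlam1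
  have hc : 0 < 2 * (M ^ 2 / (n : ℝ)) := by positivity
  have h1 : Real.log (2 * Fintype.card (Fin p → Fin (gridSize γ n)))
      ≤ (2 * B * v) ^ 2 / (2 * (M ^ 2 / n)) := by
    rw [le_div_iff₀ hc]; linarith
  have h2 : τ ^ 2 / (2 * M ^ 2) ≤ (τ * v) ^ 2 / (2 * (M ^ 2 / n)) := by
    have e : (τ * v) ^ 2 / (2 * (M ^ 2 / n)) = τ ^ 2 / (2 * M ^ 2) * (n * v ^ 2) := by
      field_simp
    rw [e]
    exact le_mul_of_one_le_right (by positivity) (one_le_mul_rpow_neg_sq hn hlam1)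
  -- Dropping the cross term splits the exponent: the part with `2 * B` absorbs the prefactor of the
  -- union bound, the part with `τ` is the tail.
  have h3 : (2 * B * v) ^ 2 / (2 * (M ^ 2 / n)) + (τ * v) ^ 2 / (2 * (M ^ 2 / n))
      ≤ ((2 * B + τ) * v) ^ 2 / (2 * (M ^ 2 / n)) := by
    rw [← add_div]
    refine div_le_div_of_nonneg_right ?_ hc.le
    have : 0 ≤ (2 * B * v) * (τ * v) := by positivity
    linarith [show ((2 * B + τ) * v) ^ 2
      = (2 * B * v) ^ 2 + (τ * v) ^ 2 + 2 * ((2 * B * v) * (τ * v)) by ring]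
  rw [neg_div, neg_div]
  linarith

end UniformDeviation

/-! ### The compromise problem -/

section Compromise

variable {E S : Type*} [NormedAddCommGroup E] [NormedSpace ℝ E] [MeasurableSpace S]
  {X : Set E} {F : E → S → ℝ} {ν : Measure S} [IsProbabilityMeasure ν] {L γ M : ℝ}
  {m n : ℕ} {ε ρ : ℝ}

omit [NormedAddCommGroup E] [NormedSpace ℝ E] [IsProbabilityMeasure ν] in
lemma supError_nonneg (s : Fin n → S) : 0 ≤ supError X F ν s :=
  Real.iSup_nonneg fun _ => abs_nonneg _

lemma compromiseDist_le (hcpt : IsCompact X) (hX : Convex ℝ X)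
    (hFmeas : ∀ x ∈ X, Measurable (F x)) (hγ0 : 0 < γ)
    (hFhol : ∀ s, ∀ x ∈ X, ∀ y ∈ X, |F x s - F y s| ≤ L * ‖x - y‖ ^ γ)
    (hFbdd : ∀ x ∈ X, ∀ s, |F x s| ≤ M) (hFconv : ∀ s, ConvexOn ℝ X fun x => F x s)
    (hm : 1 ≤ m) (hn : 1 ≤ n) (hε : 0 < ε) (hρ : 0 < ρ) (s : Fin (m * n) → S) (z : Fin m → E)
    (hz : ∀ j, z j ∈ epsOptSet X (saaObj F (block s j)) ε) :
    compromiseDist X F ν ρ ε s z ≤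
      (2 / (m : ℝ) * ∑ j : Fin m, supError X F ν (block s j)
        + 1 / (m : ℝ) ^ 2 * ∑ q ∈ (Finset.univ : Finset (Fin m)).offDiag,
          (supError X F ν (block s q.1) + supError X F ν (block s q.2))) / ε
        * Metric.diam X + 2 * √(ε / ρ) := by
  have hδ (j : Fin m) : 0 ≤ supError X F ν (block s j) := supError_nonneg _
  refine pessimisticDist_le ?_ fun a ha => ?_
  · refine add_nonneg (mul_nonneg (div_nonneg (add_nonneg ?_ ?_) hε.le) Metric.diam_nonneg)
      (by positivity)
    · exact mul_nonneg (by positivity) (Finset.sum_nonneg fun j _ => hδ j)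
    · exact mul_nonneg (by positivity)
        (Finset.sum_nonneg fun q _ => add_nonneg (hδ q.1) (hδ q.2))
  · exact exists_mem_epsOptSet_near_compromise (g := fun i => saaObj F (block s i))
      (δ := fun i => supError X F ν (block s i)) hm hcpt hX
      (fun i => convexOn_saaObj hX hFconv _)
      (fun i => continuousOn_of_holder hγ0 (abs_saaObj_sub_le hn hFhol _))
      (convexOn_trueObj hX hFmeas hFbdd hFconv)
      (continuousOn_of_holder hγ0 (abs_trueObj_sub_le hFmeas hFbdd hFhol))
      (fun i x hx => abs_saaObj_sub_trueObj_le_supError hn hFbdd _ hx) hε hρ hz ha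

lemma compromiseDist_le_sum (hcpt : IsCompact X) (hX : Convex ℝ X)
    (hFmeas : ∀ x ∈ X, Measurable (F x)) (hγ0 : 0 < γ)
    (hFhol : ∀ s, ∀ x ∈ X, ∀ y ∈ X, |F x s - F y s| ≤ L * ‖x - y‖ ^ γ)
    (hFbdd : ∀ x ∈ X, ∀ s, |F x s| ≤ M) (hFconv : ∀ s, ConvexOn ℝ X fun x => F x s)
    (hm : 1 ≤ m) (hn : 1 ≤ n) (hε : 0 < ε) (hρ : 0 < ρ) (s : Fin (m * n) → S) (z : Fin m → E)
    (hz : ∀ j, z j ∈ epsOptSet X (saaObj F (block s j)) ε) :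
    compromiseDist X F ν ρ ε s z ≤
      (4 * m - 2) / (m : ℝ) ^ 2 * (∑ j : Fin m, supError X F ν (block s j)) / ε
        * Metric.diam X + 2 * √(ε / ρ) := by
  rw [← bound_eq hm]
  exact compromiseDist_le hcpt hX hFmeas hγ0 hFhol hFbdd hFconv hm hn hε hρ s z hz

lemma compromiseDist_le_diam (hne : X.Nonempty) (hcpt : IsCompact X)
    (hFmeas : ∀ x ∈ X, Measurable (F x)) (hγ0 : 0 < γ)
    (hFhol : ∀ s, ∀ x ∈ X, ∀ y ∈ X, |F x s - F y s| ≤ L * ‖x - y‖ ^ γ)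
    (hFbdd : ∀ x ∈ X, ∀ s, |F x s| ≤ M) (hε : 0 < ε) (s : Fin (m * n) → S) (z : Fin m → E) :
    compromiseDist X F ν ρ ε s z ≤ Metric.diam X := by
  obtain ⟨x₀, hx₀, -, hopt⟩ := exists_minimizer hne hcpt
    (continuousOn_of_holder hγ0 (abs_trueObj_sub_le (ν := ν) hFmeas hFbdd hFhol))
  refine pessimisticDist_le Metric.diam_nonneg fun a ha => ⟨x₀, ⟨hx₀, by linarith⟩, ?_⟩
  rw [← dist_eq_norm]
  exact Metric.dist_le_diam_of_mem hcpt.isBounded ha.1 hx₀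

omit [IsProbabilityMeasure ν] in
lemma measurable_compromiseDist [MeasurableSpace E] [BorelSpace E]
    [SecondCountableTopology E] (hne : X.Nonempty)
    (hcpt : IsCompact X) (hX : Convex ℝ X) (hFmeas : ∀ x ∈ X, Measurable (F x)) (hγ0 : 0 < γ)
    (hFhol : ∀ s, ∀ x ∈ X, ∀ y ∈ X, |F x s - F y s| ≤ L * ‖x - y‖ ^ γ)
    (hFconv : ∀ s, ConvexOn ℝ X fun x => F x s)
    (hn : 1 ≤ n) (hε : 0 < ε) (hρ : 0 < ρ) {Ω : Type*} [MeasurableSpace Ω]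
    {ξs : Fin (m * n) → Ω → S} (hξ : ∀ k, Measurable (ξs k)) {xs : Fin m → Ω → E}
    (hxs : ∀ j, Measurable (xs j)) :
    Measurable fun ω => compromiseDist X F ν ρ ε (fun k => ξs k ω) (fun j => xs j ω) := by
  refine measurable_pessimisticDist_epsOptSet hne hcpt (fun ω => ?_) (fun ω => ?_)
    (fun x hx => ?_) hε
  · refine (convexOn_average hX fun i => convexOn_saaObj hX hFconv _).add
      (ConvexOn.smul (c := ρ / 2) (by positivity) ?_)
    simp only [← dist_eq_norm]
    exact (convexOn_dist _ hX).pow (fun _ _ => dist_nonneg) 2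
  · refine ContinuousOn.add (continuousOn_const.mul (continuousOn_finsetSum _ fun i _ =>
      continuousOn_of_holder hγ0 (abs_saaObj_sub_le hn hFhol _))) ?_
    fun_prop
  · refine Measurable.add (Measurable.const_mul (Finset.measurable_fun_sum _ fun i _ =>
      Measurable.const_mul (Finset.measurable_fun_sum _ fun j _ =>
        (hFmeas x hx).comp (hξ _)) _) _) ?_
    fun_prop

end Compromise

end CompromiseSP

/-! ### The three estimates -/

theorem theorem3p2
    {p d : ℕ} (X : Set (EuclideanSpace ℝ (Fin p))) (Ξ : Set (EuclideanSpace ℝ (Fin d)))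
    (F : EuclideanSpace ℝ (Fin p) → Ξ → ℝ)
    (ν : Measure Ξ) [IsProbabilityMeasure ν]
    (D L γ M : ℝ)
    -- the feasible region
    (hXne : X.Nonempty) (hXcpt : IsCompact X) (hXconv : Convex ℝ X)
    (hD : 0 ≤ D) (hXcube : CompromiseSP.InCube X D)
    -- the random cost function
    (hFmeas : ∀ x ∈ X, Measurable (F x))
    (hL : 0 ≤ L) (hγ0 : 0 < γ) (hγ1 : γ ≤ 1)
    (hFhol : ∀ ξ : Ξ, ∀ x ∈ X, ∀ y ∈ X, |F x ξ - F y ξ| ≤ L * ‖x - y‖ ^ γ)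
    (hM : 0 < M) (hFbdd : ∀ x ∈ X, ∀ ξ : Ξ, |F x ξ| ≤ M)
    (hFconv : ∀ ξ : Ξ, ConvexOn ℝ X (fun x => F x ξ))
    -- replications, sample size, tolerance, rate exponent
    (m n : ℕ) (hm : 1 ≤ m) (hn : 1 ≤ n)
    (ε : ℝ) (hε : 0 < ε) (lam : ℝ) (hlam0 : 0 < lam) (hlam1 : lam < 1 / 2)
    -- the i.i.d. sample
    {Ω : Type*} [MeasurableSpace Ω] (P : Measure Ω) [IsProbabilityMeasure P]
    (ξs : Fin (m * n) → Ω → Ξ) (hξmeas : ∀ k, Measurable (ξs k))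
    (hξlaw : ∀ k, P.map (ξs k) = ν) (hξindep : iIndepFun ξs P)
    -- the `ε`-optimal solutions of the replications
    (xs : Fin m → Ω → EuclideanSpace ℝ (Fin p)) (hxmeas : ∀ j, Measurable (xs j))
    (hxs : ∀ j ω, xs j ω ∈ CompromiseSP.epsOptSet X
      (CompromiseSP.saaObj F (CompromiseSP.block (fun k => ξs k ω) j)) ε) :
    -- Part 1: for all data and all `ε`-optimal solutions of the replications
    (∀ ρ : ℝ, 0 < ρ → ∀ (s : Fin (m * n) → Ξ) (z : Fin m → EuclideanSpace ℝ (Fin p)),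
      (∀ j, z j ∈ CompromiseSP.epsOptSet X
        (CompromiseSP.saaObj F (CompromiseSP.block s j)) ε) →
      CompromiseSP.compromiseDist X F ν ρ ε s z ≤
        (2 / (m : ℝ) * ∑ j : Fin m, CompromiseSP.supError X F ν (CompromiseSP.block s j)
          + 1 / (m : ℝ) ^ 2 * ∑ q ∈ (Finset.univ : Finset (Fin m)).offDiag,
              (CompromiseSP.supError X F ν (CompromiseSP.block s q.1)
                + CompromiseSP.supError X F ν (CompromiseSP.block s q.2))) / ε
          * Metric.diam X + 2 * √(ε / ρ)) ∧
    -- Part 2: the expectation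
    (∀ ρ : ℝ, 0 < ρ →
      Integrable (fun ω => CompromiseSP.compromiseDist X F ν ρ ε
        (fun k => ξs k ω) (fun j => xs j ω)) P ∧
      ∫ ω, CompromiseSP.compromiseDist X F ν ρ ε (fun k => ξs k ω) (fun j => xs j ω) ∂P ≤
        Metric.diam X * CompromiseSP.constNF p D L γ M lam / ε
          * ((8 * (m : ℝ) - 4) / ((m : ℝ) * (n : ℝ) ^ lam)) + 2 * √(ε / ρ)) ∧
    -- Part 3: the tail bound, for `ρ = n`
    (0 < Metric.diam X → ∀ t : ℝ, 0 ≤ t →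
      P.real {ω | ε ^ (3 / 2 : ℝ) / Metric.diam X
            + (4 * (m : ℝ) - 2) * CompromiseSP.constNF p D L γ M lam / (m : ℝ) + t ≤
          ε * (n : ℝ) ^ lam / (2 * Metric.diam X)
            * CompromiseSP.compromiseDist X F ν (n : ℝ) ε
                (fun k => ξs k ω) (fun j => xs j ω)} ≤
        (m : ℝ) * Real.exp
          (-((m : ℝ) ^ 2 * t ^ 2) / (2 * M ^ 2 * (2 * (m : ℝ) - 1) ^ 2))) := by
  have hblk (j : Fin m) : (∀ k, Measurable fun ω => ξs (finProdFinEquiv (j, k)) ω) ∧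
      (∀ k : Fin n, P.map (ξs (finProdFinEquiv (j, k))) = ν) ∧
      iIndepFun (fun k : Fin n => ξs (finProdFinEquiv (j, k))) P :=
    ⟨fun k => hξmeas _, fun k => hξlaw _, hξindep.precomp
      (finProdFinEquiv.injective.comp (Prod.mk_right_injective j))⟩
  have hm0 : (0 : ℝ) < m := by exact_mod_cast hm
  have hm1 : (1 : ℝ) ≤ m := by exact_mod_cast hm
  have hn0 : (0 : ℝ) < n := by exact_mod_cast hn
  have hn1 : (1 : ℝ) ≤ n := by exact_mod_cast hn
  have hdist (ρ : ℝ) (hρ : 0 < ρ) (ω : Ω) :=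
    CompromiseSP.compromiseDist_le_sum (ν := ν) hXcpt hXconv hFmeas hγ0 hFhol hFbdd hFconv hm hn
      hε hρ (fun k => ξs k ω) (fun j => xs j ω) fun j => hxs j ω
  refine ⟨fun ρ hρ s z hz => CompromiseSP.compromiseDist_le hXcpt hXconv hFmeas hγ0 hFhol hFbdd
    hFconv hm hn hε hρ s z hz, fun ρ hρ => ?_, fun hdiam t ht => ?_⟩
  · have hint : Integrable (fun ω => CompromiseSP.compromiseDist X F ν ρ ε
        (fun k => ξs k ω) (fun j => xs j ω)) P := by
      refine Integrable.of_bound (CompromiseSP.measurable_compromiseDist hXne hXcpt hXconv hFmeas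
        hγ0 hFhol hFconv hn hε hρ hξmeas hxmeas).aestronglyMeasurable (Metric.diam X)
        (Filter.Eventually.of_forall fun ω => ?_)
      rw [CompromiseSP.compromiseDist,
        Real.norm_of_nonneg (CompromiseSP.pessimisticDist_nonneg _ _)]
      exact CompromiseSP.compromiseDist_le_diam hXne hXcpt hFmeas hγ0 hFhol hFbdd hε _ _
    refine ⟨hint, ?_⟩
    choose G hGi hG hGint using fun j : Fin m =>
      CompromiseSP.exists_supError_majorant (lam := lam) hXne hD hXcube hFmeas hL hγ0 hγ1 hFhol hM
        hFbdd hn hlam1 (hblk j).1 (hblk j).2.1 (hblk j).2.2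
    have hcoef : 0 ≤ (4 * (m : ℝ) - 2) / (m : ℝ) ^ 2 :=
      div_nonneg (by linarith) (by positivity)
    have hsumi : Integrable (fun ω => ∑ j, G j ω) P := integrable_finsetSum _ fun j _ => hGi j
    have hmaj : Integrable (fun ω => (4 * (m : ℝ) - 2) / (m : ℝ) ^ 2 * (∑ j, G j ω) / ε
        * Metric.diam X + 2 * √(ε / ρ)) P :=
      (((hsumi.const_mul _).div_const _).mul_const _).add (integrable_const _)
    have hle : ∫ ω, CompromiseSP.compromiseDist X F ν ρ ε (fun k => ξs k ω) (fun j => xs j ω) ∂P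
        ≤ ∫ ω, ((4 * (m : ℝ) - 2) / (m : ℝ) ^ 2 * (∑ j, G j ω) / ε
          * Metric.diam X + 2 * √(ε / ρ)) ∂P := by
      refine integral_mono hint hmaj fun ω => (hdist ρ hρ ω).trans ?_
      have hsum := Finset.sum_le_sum fun j (_ : j ∈ Finset.univ) => hG j ω
      have h1 := mul_le_mul_of_nonneg_left hsum hcoef
      exact add_le_add_left (mul_le_mul_of_nonneg_right
        (div_le_div_of_nonneg_right h1 hε.le) Metric.diam_nonneg) _
    refine hle.trans ?_
    rw [integral_add (((hsumi.const_mul _).div_const _).mul_const _) (integrable_const _),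
      integral_mul_const, integral_div, integral_const_mul,
      integral_finsetSum _ fun j _ => hGi j]
    simp only [integral_const, probReal_univ, one_smul]
    refine add_le_add_left ?_ _
    have hsum := Finset.sum_le_sum fun j (_ : j ∈ Finset.univ) => hGint j
    rw [Finset.sum_const, Finset.card_univ, Fintype.card_fin, nsmul_eq_mul] at hsum
    have h1 := mul_le_mul_of_nonneg_left hsum hcoef
    refine (mul_le_mul_of_nonneg_right
      (div_le_div_of_nonneg_right h1 hε.le) Metric.diam_nonneg).trans_eq ?_
    rw [Real.rpow_neg hn0.le]
    field_simp
    ring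
  · set N := CompromiseSP.constNF p D L γ M lam with hN
    -- Chosen so that `(2 * m - 1) / m ^ 2 * (m * τ) = t`.
    set τ := (m : ℝ) * t / (2 * m - 1) with hτ
    have h2m : 0 < 2 * (m : ℝ) - 1 := by linarith
    have hτ0 : 0 ≤ τ := by positivity
    have hsub : {ω | ε ^ (3 / 2 : ℝ) / Metric.diam X
          + (4 * (m : ℝ) - 2) * N / (m : ℝ) + t ≤ ε * (n : ℝ) ^ lam / (2 * Metric.diam X)
            * CompromiseSP.compromiseDist X F ν (n : ℝ) ε (fun k => ξs k ω) (fun j => xs j ω)}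
        -- If every replication error stays below its threshold, so does the average, hence the
        -- distance. The union bound over replications then gives the factor `m`.
        ⊆ ⋃ j : Fin m, {ω | 2 * N + τ ≤ (n : ℝ) ^ lam
          * CompromiseSP.supError X F ν (fun k : Fin n => ξs (finProdFinEquiv (j, k)) ω)} := by
      intro ω hω
      by_contra hcon
      simp only [Set.mem_iUnion, Set.mem_ofPred_eq, not_exists, not_le] at hcon hω
      have : Nonempty (Fin m) := ⟨⟨0, hm⟩⟩
      have hsum := Finset.sum_lt_sum_of_nonempty Finset.univ_nonempty
        fun j (_ : j ∈ Finset.univ) => hcon j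
      rw [Finset.sum_const, Finset.card_univ, Fintype.card_fin, nsmul_eq_mul,
        ← Finset.mul_sum] at hsum
      have hd := hdist n hn0 ω
      change _ ≤ (4 * (m : ℝ) - 2) / (m : ℝ) ^ 2 * (∑ j : Fin m,
        CompromiseSP.supError X F ν (fun k : Fin n => ξs (finProdFinEquiv (j, k)) ω)) / ε
          * Metric.diam X + 2 * √(ε / n) at hd
      set δs := ∑ j : Fin m,
        CompromiseSP.supError X F ν (fun k : Fin n => ξs (finProdFinEquiv (j, k)) ω)
      -- With `ρ = n` and `lam < 1 / 2`, the penalty term decays at least as fast as `n ^ (-lam)`;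
      -- this gives the first summand of the threshold.
      have hsqrt : ε * (n : ℝ) ^ lam * √(ε / n) ≤ ε ^ (3 / 2 : ℝ) := by
        have e1 : ε ^ (3 / 2 : ℝ) = ε * √ε := by
          rw [Real.sqrt_eq_rpow, show (3 / 2 : ℝ) = 1 + 1 / 2 by norm_num, Real.rpow_add hε,
            Real.rpow_one]
        have e2 : (n : ℝ) ^ lam ≤ √n := by
          rw [Real.sqrt_eq_rpow]
          exact Real.rpow_le_rpow_of_exponent_le hn1 hlam1.le
        rw [e1, mul_assoc, Real.sqrt_div hε.le]
        refine mul_le_mul_of_nonneg_left ?_ hε.le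
        rw [← mul_div_assoc, div_le_iff₀ (Real.sqrt_pos.2 hn0), mul_comm (√ε)]
        exact mul_le_mul_of_nonneg_right e2 (Real.sqrt_nonneg _)
      have hcoef : 0 < ε * (n : ℝ) ^ lam / (2 * Metric.diam X) := by positivity
      have h1 := hω.trans (mul_le_mul_of_nonneg_left hd hcoef.le)
      have h2 : ε * (n : ℝ) ^ lam / (2 * Metric.diam X) * ((4 * (m : ℝ) - 2) / (m : ℝ) ^ 2
          * δs / ε * Metric.diam X + 2 * √(ε / n))
          = (2 * m - 1) / (m : ℝ) ^ 2 * ((n : ℝ) ^ lam * δs)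
            + ε * (n : ℝ) ^ lam * √(ε / n) / Metric.diam X := by
        field_simp
        ring
      have h3 := mul_lt_mul_of_pos_left hsum (by positivity : 0 < (2 * m - 1) / (m : ℝ) ^ 2)
      have h4 : (2 * m - 1) / (m : ℝ) ^ 2 * (m * (2 * N + τ))
          = (4 * (m : ℝ) - 2) * N / m + t := by
        rw [hτ]
        field_simp
        ring
      have h5 := div_le_div_of_nonneg_right hsqrt hdiam.le
      linarith
    refine (measureReal_mono hsub).trans ((measureReal_iUnion_fintype_le _).trans ?_)
    refine (Finset.sum_le_sum fun j _ => CompromiseSP.measureReal_supError_ge_le hXne hD hXcube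
      hFmeas hL hγ0 hγ1 hFhol hM hFbdd hn hlam1 (hblk j).1 (hblk j).2.1 (hblk j).2.2
      hτ0).trans_eq ?_
    rw [Finset.sum_const, Finset.card_univ, Fintype.card_fin, nsmul_eq_mul]
    congr 2
    rw [hτ]
    field_simp
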